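/- Let $p,d,n,K\ge 1$ be integers and let $\|\cdot\|$ be the Euclidean norm. Let $\mathcal X\subseteq\mathbb R^p$ be compact with $\max_{x\in\mathcal X}\|x\|_\infty=\bar X>0$, let $(X,Y)$ be a random pair with values in $\mathcal X\times\mathcal Y$, and let $S=\{(x^s,y^s)\}_{s=1}^n$ be i.i.d. copies of $(X,Y)$. Let $\varphi:\mathbb R^d\times\mathcal Y\to\mathbb R$ be a cost function, measurable in its second argument, such that for some $L_\varphi,C_\varphi>0$ and $z_0\in\mathbb R^d$ and all $y\in\mathcal Y$, the function $\varphi(\cdot;y)$ is $L_\varphi$-Lipschitz on $\mathbb R^d$ and $|\varphi(z_0;y)|\le C_\varphi$. For $f:\mathcal X\to\mathbb R^d$ put $$R(f)=\mathbb E[\varphi(f(X);Y)],\qquad \widehat R_S(f)=\frac1n\sum_{s=1}^n\varphi(f(x^s);y^s),$$ where the expectation is extended-real valued and equals $+\infty$ if the positive part is not integrable, and let $\mathcal F$ be the set of all measurable functions $\mathcal X\to\mathbb R^d$. Suppose that some $f^*\in\mathcal F$ minimizes $R$ over $\mathcal F$ and that, for some $L_z,M_z>0$, $f^*$ is $L_z$-Lipschitz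 and $|f^*_\iota(x)|\le M_z$ for all $x\in\mathcal X$ and $\iota\in\{1,\dots,d\}$. Let $\mathcal H^K_\mu$ be the class of piecewise affine decision rules (PADR), that is, of the functions $f=(f_\iota)_{\iota=1}^d:\mathcal X\to\mathbb R^d$ with $$f_\iota(x)=\max_{1\le k\le K}\{(\alpha^k_\iota)^\top x+a^k_\iota\}-\max_{1\le k\le K}\{(\beta^k_\iota)^\top x+b^k_\iota\},$$ where all entries of $\alpha^k_\iota,\beta^k_\iota\in\mathbb R^p$ and $a^k_\iota,b^k_\iota\in\mathbb R$ have absolute value at most $\mu$. Assume $$\mu\ge\max\left\{\tfrac12L_zK^{1/p},\ \tfrac14pL_z\bar XK^{1/p}+\tfrac12M_z\right\},\qquad M_\mu:=C_\varphi+L_\varphi\left(2\sqrt d\,\mu(p\bar X+1)+\|z_0\|\right),$$ and let $\delta>0$. Then $\widehat R_S$ has a minimizer over $\mathcal H^K_\mu$, and with probability at least $1-\delta$ over the draw of $S$, every minimizer $f^*_S$ of $\widehat R_S$ over $\mathcal H^K_\mu$ satisfies $$\begin{aligned}R(f^*_S)\le{}&\inf_{f\in\mathcal F}R(f)+2d^{1/2}(p^{1/2}+3)p^{1/2}L_\varphi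 L_z\bar XK^{-1/p}+\frac{16\mu L_\varphi\sqrt{2dK(p+1)(p\bar X^2+1)}}{n}\\&+4M_\mu\sqrt{\frac{2dK(p+1)\log n}{n}}+2\sqrt2\,M_\mu\sqrt{\frac{\log(2/\delta)}{n}}.\end{aligned}$$ -/

import Mathlib

open MeasureTheory ProbabilityTheory

/-- The parameter `(α^k, a^k, β^k, b^k)_{k = 1, …, K}` in `ℝ^(2 K (p + 1))` of a difference of two
max-affine functions on `ℝ^p` with `K` pieces each. Mathlib's norm on this product type is the
maximum of the absolute values of all entries, i.e. the sup-norm. -/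
abbrev PAParam (p K : ℕ) : Type :=
  (Fin K → Fin p → ℝ) × (Fin K → ℝ) × (Fin K → Fin p → ℝ) × (Fin K → ℝ)

/-- `max_k (⟨α^k, x⟩ + a^k)`, the maximum being over `k` in `Fin K` (used with `K ≥ 1`). -/
noncomputable def maxAffine {p K : ℕ} (α : Fin K → Fin p → ℝ) (a : Fin K → ℝ)
    (x : EuclideanSpace ℝ (Fin p)) : ℝ :=
  ⨆ k : Fin K, ((∑ j : Fin p, α k j * x j) + a k)

/-- The piecewise affine function `max_k (⟨α^k, x⟩ + a^k) - max_k (⟨β^k, x⟩ + b^k)`. -/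
noncomputable def paFun {p K : ℕ} (θ : PAParam p K) (x : EuclideanSpace ℝ (Fin p)) : ℝ :=
  maxAffine θ.1 θ.2.1 x - maxAffine θ.2.2.1 θ.2.2.2 x

/-- The class of piecewise affine decision rules `𝒳 → ℝ^d`: every component is a difference of two
max-affine functions with `K` pieces whose parameter has sup-norm at most `μ`. -/
def padrClass {p : ℕ} (𝒳 : Set (EuclideanSpace ℝ (Fin p))) (d K : ℕ) (μ : ℝ) :
    Set (𝒳 → EuclideanSpace ℝ (Fin d)) :=
  {f | ∃ θ : Fin d → PAParam p K, (∀ i, ‖θ i‖ ≤ μ) ∧ ∀ (x : 𝒳) (i : Fin d), f x i = paFun (θ i) x}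

/-- The functions `𝒳 → ℝ^d` that are `L`-Lipschitz for the Euclidean norms and all of whose
components are bounded by `M` in absolute value. -/
def lipClass {p : ℕ} (𝒳 : Set (EuclideanSpace ℝ (Fin p))) (d : ℕ) (L M : ℝ) :
    Set (𝒳 → EuclideanSpace ℝ (Fin d)) :=
  {f | (∀ (x : 𝒳) (i : Fin d), |f x i| ≤ M) ∧
    ∀ x x' : 𝒳, ‖f x - f x'‖ ≤ L * ‖(x : EuclideanSpace ℝ (Fin p)) - x'‖}

open Classical in
/-- The extended-real expectation `E[g⁺] - E[g⁻]`, with value `+∞` whenever `E[g⁺] = +∞` (the usual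
convention for minimization). For an integrable `g` it is the ordinary expectation. -/
noncomputable def extExpectation {Ω : Type*} [MeasurableSpace Ω] (P : Measure Ω) (g : Ω → ℝ) :
    EReal :=
  if ∫⁻ ω, ENNReal.ofReal (g ω) ∂P = ⊤ then ⊤
  else ((∫⁻ ω, ENNReal.ofReal (g ω) ∂P : ENNReal) : EReal)
    - ((∫⁻ ω, ENNReal.ofReal (-g ω) ∂P : ENNReal) : EReal)

/-- The risk `R(f) = E[φ(f(X); Y)]` of a decision rule `f`, where `(X, Y)` has law `P`. -/
noncomputable def risk {𝒳 𝒴 Z : Type*} [MeasurableSpace 𝒳] [MeasurableSpace 𝒴]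
    (P : Measure (𝒳 × 𝒴)) (φ : Z → 𝒴 → ℝ) (f : 𝒳 → Z) : EReal :=
  extExpectation P fun q => φ (f q.1) q.2

/-- The empirical risk `(1/n) ∑_s φ(f(x^s); y^s)` of a decision rule `f`. -/
noncomputable def empRisk {𝒳 𝒴 Z : Type*} {n : ℕ} (φ : Z → 𝒴 → ℝ) (S : Fin n → 𝒳 × 𝒴)
    (f : 𝒳 → Z) : ℝ :=
  (1 / (n : ℝ)) * ∑ s : Fin n, φ (f (S s).1) (S s).2

/-- The set of solutions of the empirical risk minimization problem over a class `H`. -/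
def ermSolutions {𝒳 𝒴 Z : Type*} {n : ℕ} (φ : Z → 𝒴 → ℝ) (S : Fin n → 𝒳 × 𝒴)
    (H : Set (𝒳 → Z)) : Set (𝒳 → Z) :=
  {f | f ∈ H ∧ ∀ g ∈ H, empRisk φ S f ≤ empRisk φ S g}

/-!
A function `g` is the difference of `lam * ‖x‖ ^ 2 + g / 2` and `lam * ‖x‖ ^ 2 - g / 2`. For a
Lipschitz `g`, the functions `± g / 2` are, up to `O(1 / lam)`, suprema of the downward paraboloids
`± g c / 2 - lam * ‖x - c‖ ^ 2`; adding `lam * ‖x‖ ^ 2` turns each paraboloid into an affine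
function. Taking only the `K` centres `c` of a grid of mesh `≈ Xbar * K ^ (-1 / p)` and balancing
`lam` against the mesh gives a piecewise affine rule at distance `O(K ^ (-1 / p))` from the optimal
rule.

The estimation error is controlled by Hoeffding's inequality: a piecewise affine rule is Lipschitz
in its parameter, and the cube of `2 d K (p + 1)` parameters of size `μ` is covered by `n ^ (2 d K
(p + 1))` balls of radius `μ / n`, so a union bound over the centres makes the empirical risk
uniformly close to the risk. Half of the failure probability `δ` is spent on this bound and half
on the fixed approximating rule.
-/

section Covering

open Metric Set
open scoped NNReal ENNReal

section PseudoEMetric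

variable {E F : Type*} [PseudoEMetricSpace E] [PseudoEMetricSpace F] {ε : ℝ≥0}

theorem exists_isCover_encard_eq_coveringNumber (ε : ℝ≥0) (s : Set E) :
    ∃ C ⊆ s, IsCover ε s C ∧ C.encard = coveringNumber ε s := by
  by_cases h : coveringNumber ε s = ⊤
  · exact ⟨s, Subset.rfl, .rfl, (top_le_iff.1 (h ▸ coveringNumber_le_encard_self s)).trans h.symm⟩
  · obtain ⟨C, hCs, -, hC, hcard⟩ := exists_set_encard_eq_coveringNumber h
    exact ⟨C, hCs, hC, hcard⟩

theorem coveringNumber_prod_le (s : Set E) (t : Set F) :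
    coveringNumber ε (s ×ˢ t) ≤ coveringNumber ε s * coveringNumber ε t := by
  obtain ⟨C, hCs, hC, hC_card⟩ := exists_isCover_encard_eq_coveringNumber ε s
  obtain ⟨D, hDt, hD, hD_card⟩ := exists_isCover_encard_eq_coveringNumber ε t
  rw [← hC_card, ← hD_card, ← encard_prod]
  refine IsCover.coveringNumber_le_encard (prod_mono hCs hDt) ?_
  rintro ⟨x, y⟩ ⟨hx, hy⟩
  obtain ⟨x', hx', hxx'⟩ := hC hx
  obtain ⟨y', hy', hyy'⟩ := hD hy
  have hdist : edist (x, y) (x', y') ≤ ε := max_le hxx' hyy'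
  exact ⟨(x', y'), ⟨hx', hy'⟩, hdist⟩

theorem coveringNumber_univ_pi_le {ι : Type*} [Fintype ι] {X : ι → Type*}
    [∀ i, PseudoEMetricSpace (X i)] (s : ∀ i, Set (X i)) :
    coveringNumber ε (univ.pi s) ≤ ∏ i, coveringNumber ε (s i) := by
  choose C hCs hC hC_card using fun i => exists_isCover_encard_eq_coveringNumber ε (s i)
  simp_rw [← hC_card, ← encard_pi_eq_prod_encard]
  refine IsCover.coveringNumber_le_encard (pi_mono fun i _ => hCs i) fun x hx => ?_
  choose y hyC hxy using fun i => hC i (hx i (mem_univ i))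
  exact ⟨y, fun i _ => hyC i, edist_pi_le_iff.2 hxy⟩

end PseudoEMetric

theorem coveringNumber_closedBall_prod_le {E F : Type*} [PseudoMetricSpace E] [PseudoMetricSpace F]
    {ε : ℝ≥0} (x : E × F) (r : ℝ) :
    coveringNumber ε (closedBall x r) ≤
      coveringNumber ε (closedBall x.1 r) * coveringNumber ε (closedBall x.2 r) := by
  rw [← closedBall_prod_same x.1 x.2 r]
  exact coveringNumber_prod_le _ _

theorem coveringNumber_closedBall_pi_le {ι : Type*} [Fintype ι] {X : ι → Type*}
    [∀ i, PseudoMetricSpace (X i)] {ε : ℝ≥0} {N : ℕ∞} {x : ∀ i, X i} {r : ℝ} (hr : 0 ≤ r)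
    (h : ∀ i, coveringNumber ε (closedBall (x i) r) ≤ N) :
    coveringNumber ε (closedBall x r) ≤ N ^ Fintype.card ι := by
  rw [closedBall_pi x hr]
  exact (coveringNumber_univ_pi_le _).trans (Finset.prod_le_pow_card _ _ _ fun i _ => h i)

theorem exists_fin_abs_sub_add_half_le {n : ℕ} (hn : 1 ≤ n) {u : ℝ} (hu : 0 ≤ u) (hun : u ≤ n) :
    ∃ i : Fin n, |u - (i + 1 / 2)| ≤ 1 / 2 := by
  obtain rfl | hlt := hun.eq_or_lt
  · refine ⟨⟨n - 1, by omega⟩, ?_⟩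
    rw [Nat.cast_sub hn, Nat.cast_one]
    exact abs_le.2 ⟨by linarith, by linarith⟩
  · refine ⟨⟨⌊u⌋₊, (Nat.floor_lt hu).2 hlt⟩, abs_le.2 ⟨?_, ?_⟩⟩
    · linarith [Nat.floor_le hu]
    · linarith [Nat.lt_floor_add_one u]

theorem coveringNumber_closedBall_real_le (x : ℝ) (r : ℝ≥0) {n : ℕ} (hn : 1 ≤ n) :
    coveringNumber (r / n) (closedBall x r) ≤ n := by
  have hn0 : (0 : ℝ) < n := by exact_mod_cast hn
  -- The midpoints of the `n` intervals of length `2 r / n` that partition the ball.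
  let c : Fin n → ℝ := fun i => x - r + 2 * r / n * (i + 1 / 2)
  have hc : range c ⊆ closedBall x r := by
    rintro _ ⟨i, rfl⟩
    have hi : ((i : ℝ) + 1 / 2) / n ≤ 1 := by
      rw [div_le_one hn0]
      have : (i : ℝ) + 1 ≤ n := by exact_mod_cast i.2
      linarith
    have hi0 : 0 ≤ ((i : ℝ) + 1 / 2) / n := by positivity
    have hci : c i - x = r * (2 * (((i : ℝ) + 1 / 2) / n) - 1) := by simp only [c]; ring
    rw [mem_closedBall, Real.dist_eq, hci, abs_mul, NNReal.abs_eq]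
    exact mul_le_of_le_one_right r.2 (abs_le.2 ⟨by linarith, by linarith⟩)
  have hcover : IsCover (r / n) (closedBall x r) (range c) := by
    rw [isCover_iff_subset_iUnion_closedBall, Real.closedBall_eq_Icc, biUnion_range,
      ← segment_eq_Icc (by linarith [r.2]), segment_eq_image_lineMap]
    rintro _ ⟨t, ht, rfl⟩
    obtain ⟨i, hi⟩ := exists_fin_abs_sub_add_half_le hn (mul_nonneg hn0.le ht.1)
      (mul_le_of_le_one_right hn0.le ht.2)
    refine mem_iUnion.2 ⟨i, ?_⟩
    have hdiff : AffineMap.lineMap (x - r) (x + r) t - c i =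
        2 * r / n * (n * t - (i + 1 / 2)) := by
      simp only [AffineMap.lineMap_apply, vsub_eq_sub, smul_eq_mul, vadd_eq_add, c]
      field_simp
      ring
    rw [mem_closedBall, Real.dist_eq, hdiff, abs_mul, abs_of_nonneg (by positivity)]
    calc 2 * (r : ℝ) / n * |n * t - (i + 1 / 2)| ≤ 2 * r / n * (1 / 2) := by gcongr
      _ = ((r / n : ℝ≥0) : ℝ) := by push_cast; ring
  calc coveringNumber (r / n) (closedBall x r) ≤ (range c).encard :=
        hcover.coveringNumber_le_encard hc
    _ ≤ n := by
        rw [← image_univ]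
        exact (encard_image_le c univ).trans (by simp)

theorem coveringNumber_closedBall_paParam_le (d p K : ℕ) (r : ℝ≥0) {n : ℕ} (hn : 1 ≤ n) :
    coveringNumber (r / n) (closedBall (0 : Fin d → PAParam p K) r) ≤
      (n ^ (2 * d * K * (p + 1)) : ℕ) := by
  have hvec : coveringNumber (r / n) (closedBall (0 : Fin K → ℝ) r) ≤ (n : ℕ∞) ^ K := by
    simpa using coveringNumber_closedBall_pi_le (x := (0 : Fin K → ℝ)) r.2
      fun _ => coveringNumber_closedBall_real_le 0 r hn
  have hmat : coveringNumber (r / n) (closedBall (0 : Fin K → Fin p → ℝ) r) ≤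
      ((n : ℕ∞) ^ p) ^ K := by
    simpa using coveringNumber_closedBall_pi_le (x := (0 : Fin K → Fin p → ℝ)) r.2
      fun _ => coveringNumber_closedBall_pi_le r.2
        fun _ => coveringNumber_closedBall_real_le 0 r hn
  have hparam : coveringNumber (r / n) (closedBall (0 : PAParam p K) r) ≤
      ((n : ℕ∞) ^ p) ^ K * ((n : ℕ∞) ^ K * (((n : ℕ∞) ^ p) ^ K * (n : ℕ∞) ^ K)) := by
    refine (coveringNumber_closedBall_prod_le _ _).trans (mul_le_mul' hmat ?_)
    refine (coveringNumber_closedBall_prod_le _ _).trans (mul_le_mul' hvec ?_)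
    exact (coveringNumber_closedBall_prod_le _ _).trans (mul_le_mul' hmat hvec)
  have hall := coveringNumber_closedBall_pi_le (x := (0 : Fin d → PAParam p K)) r.2
    fun _ => hparam
  refine hall.trans_eq ?_
  rw [Fintype.card_fin]
  push_cast
  ring

theorem exists_fin_cover_of_coveringNumber_le {E : Type*} [PseudoMetricSpace E] {T : Set E}
    (hT : T.Nonempty) {ε : ℝ≥0} {N : ℕ} (hN : coveringNumber ε T ≤ N) :
    ∃ c : Fin N → E, (∀ k, c k ∈ T) ∧ ∀ x ∈ T, ∃ k, dist x (c k) ≤ ε := by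
  obtain ⟨C, hCT, hC, hcard⟩ := exists_isCover_encard_eq_coveringNumber ε T
  obtain ⟨hfin, hncard⟩ := encard_le_coe_iff_finite_ncard_le.1 (hcard.trans_le hN)
  have : Finite C := hfin
  have : Nonempty C := (hC.nonempty hT).to_subtype
  obtain ⟨c, hc⟩ : ∃ c : Fin N → C, Function.Surjective c := by
    have := Fintype.ofFinite C
    obtain ⟨e⟩ := Function.Embedding.nonempty_of_card_le (α := C) (β := Fin N) <| by
      rwa [← Nat.card_eq_fintype_card, Nat.card_coe_set_eq, Fintype.card_fin]
    exact ⟨_, Function.invFun_surjective e.injective⟩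
  refine ⟨fun k => c k, fun k => hCT (c k).2, fun x hx => ?_⟩
  obtain ⟨y, hy, hxy⟩ := mem_iUnion₂.1 (isCover_iff_subset_iUnion_closedBall.1 hC hx)
  obtain ⟨k, hk⟩ := hc ⟨y, hy⟩
  exact ⟨k, by simpa only [hk, mem_closedBall] using hxy⟩

end Covering

section MaxAffine

open Set
open scoped NNReal

theorem lipschitzWith_iSup_pi {ι : Type*} [Fintype ι] :
    LipschitzWith 1 fun f : ι → ℝ => ⨆ i, f i := by
  cases isEmpty_or_nonempty ι
  · simpa only [Real.iSup_of_isEmpty] using LipschitzWith.const' (0 : ℝ)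
  · refine LipschitzWith.of_le_add fun f g => ciSup_le fun i => ?_
    calc f i ≤ g i + dist f g := by
          linarith [(le_abs_self (f i - g i)).trans (dist_le_pi_dist f g i)]
      _ ≤ (⨆ i, g i) + dist f g := by
          gcongr
          exact le_ciSup (finite_range g).bddAbove i

theorem norm_le_sqrt_card_mul_norm_ofLp {ι : Type*} [Fintype ι] (x : EuclideanSpace ℝ ι) :
    ‖x‖ ≤ √(Fintype.card ι) * ‖WithLp.ofLp x‖ := by
  have h := (PiLp.lipschitzWith_toLp 2 fun _ : ι => ℝ).dist_le_mul (WithLp.ofLp x) 0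
  simpa [Real.sqrt_eq_rpow] using h

variable {p K : ℕ}

@[fun_prop]
theorem continuous_maxAffine {T : Type*} [TopologicalSpace T] {α : T → Fin K → Fin p → ℝ}
    {a : T → Fin K → ℝ} {x : T → EuclideanSpace ℝ (Fin p)} (hα : Continuous α) (ha : Continuous a)
    (hx : Continuous x) : Continuous fun t => maxAffine (α t) (a t) (x t) :=
  lipschitzWith_iSup_pi.continuous.comp (by fun_prop)

@[fun_prop]
theorem continuous_paFun {T : Type*} [TopologicalSpace T] {θ : T → PAParam p K}
    {x : T → EuclideanSpace ℝ (Fin p)} (hθ : Continuous θ) (hx : Continuous x) :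
    Continuous fun t => paFun (θ t) (x t) := by
  unfold paFun
  fun_prop

theorem abs_maxAffine_sub_maxAffine_le (α α' : Fin K → Fin p → ℝ) (a a' : Fin K → ℝ)
    (x : EuclideanSpace ℝ (Fin p)) :
    |maxAffine α a x - maxAffine α' a' x| ≤ p * ‖WithLp.ofLp x‖ * ‖α - α'‖ + ‖a - a'‖ := by
  refine ((lipschitzWith_iSup_pi (ι := Fin K)).dist_le_mul _ _).trans ?_
  rw [NNReal.coe_one, one_mul]
  refine (dist_pi_le_iff (by positivity)).2 fun k => ?_
  have hlin : |∑ j, (α k j - α' k j) * x j| ≤ ∑ _j : Fin p, ‖α - α'‖ * ‖WithLp.ofLp x‖ := by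
    refine (Finset.abs_sum_le_sum_abs _ _).trans (Finset.sum_le_sum fun j _ => ?_)
    rw [abs_mul]
    gcongr
    · exact (norm_le_pi_norm ((α - α') k) j).trans (norm_le_pi_norm (α - α') k)
    · exact norm_le_pi_norm (WithLp.ofLp x) j
  calc dist (∑ j, α k j * x j + a k) (∑ j, α' k j * x j + a' k)
      = |∑ j, (α k j - α' k j) * x j + (a k - a' k)| := by
        rw [Real.dist_eq]
        simp only [sub_mul, Finset.sum_sub_distrib]
        ring_nf
    _ ≤ |∑ j, (α k j - α' k j) * x j| + |a k - a' k| := abs_add_le _ _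
    _ ≤ ∑ _j : Fin p, ‖α - α'‖ * ‖WithLp.ofLp x‖ + ‖a - a'‖ :=
        add_le_add hlin (norm_le_pi_norm (a - a') k)
    _ = p * ‖WithLp.ofLp x‖ * ‖α - α'‖ + ‖a - a'‖ := by
        rw [Finset.sum_const, Finset.card_univ, Fintype.card_fin, nsmul_eq_mul]
        ring

theorem abs_paFun_sub_paFun_le (θ θ' : PAParam p K) (x : EuclideanSpace ℝ (Fin p)) :
    |paFun θ x - paFun θ' x| ≤ 2 * (p * ‖WithLp.ofLp x‖ + 1) * ‖θ - θ'‖ := by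
  obtain ⟨hα, ha, hβ, hb⟩ : ‖θ.1 - θ'.1‖ ≤ ‖θ - θ'‖ ∧ ‖θ.2.1 - θ'.2.1‖ ≤ ‖θ - θ'‖ ∧
      ‖θ.2.2.1 - θ'.2.2.1‖ ≤ ‖θ - θ'‖ ∧ ‖θ.2.2.2 - θ'.2.2.2‖ ≤ ‖θ - θ'‖ := by
    simpa only [norm_prod_le_iff, Prod.fst_sub, Prod.snd_sub] using le_refl ‖θ - θ'‖
  calc |paFun θ x - paFun θ' x|
      = |(maxAffine θ.1 θ.2.1 x - maxAffine θ'.1 θ'.2.1 x) -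
          (maxAffine θ.2.2.1 θ.2.2.2 x - maxAffine θ'.2.2.1 θ'.2.2.2 x)| := by
        unfold paFun
        ring_nf
    _ ≤ (p * ‖WithLp.ofLp x‖ * ‖θ.1 - θ'.1‖ + ‖θ.2.1 - θ'.2.1‖) +
          (p * ‖WithLp.ofLp x‖ * ‖θ.2.2.1 - θ'.2.2.1‖ + ‖θ.2.2.2 - θ'.2.2.2‖) :=
        (abs_sub _ _).trans (add_le_add (abs_maxAffine_sub_maxAffine_le _ _ _ _ _)
          (abs_maxAffine_sub_maxAffine_le _ _ _ _ _))
    _ ≤ (p * ‖WithLp.ofLp x‖ * ‖θ - θ'‖ + ‖θ - θ'‖) +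
          (p * ‖WithLp.ofLp x‖ * ‖θ - θ'‖ + ‖θ - θ'‖) := by gcongr
    _ = 2 * (p * ‖WithLp.ofLp x‖ + 1) * ‖θ - θ'‖ := by ring

end MaxAffine

section QuadraticSupConvolution

open Set
open scoped NNReal

variable {E κ : Type*} [PseudoMetricSpace E] {lam D : ℝ} {L : ℝ≥0} {h : E → ℝ} {c : κ → E} {x : E}

/-- The quadratic sup-convolution of `h` with penalty `lam`, the supremum being restricted to the
centres `c k`. It approximates a Lipschitz function near the centres and, up to the term
`lam * ‖x‖ ^ 2`, is a maximum of affine functions. -/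
noncomputable def quadSupConv (lam : ℝ) (h : E → ℝ) (c : κ → E) (x : E) : ℝ :=
  ⨆ k, (h (c k) - lam * dist x (c k) ^ 2)

theorem quadSupConv_le [Nonempty κ] (hlam : 0 < lam) (hh : LipschitzWith L h) :
    quadSupConv lam h c x ≤ h x + L ^ 2 / (4 * lam) := by
  refine ciSup_le fun k => ?_
  have hlip : h (c k) ≤ h x + L * dist x (c k) := by
    rw [dist_comm]
    exact hh.le_add_mul _ _
  have hquad : L * dist x (c k) - lam * dist x (c k) ^ 2 ≤ L ^ 2 / (4 * lam) := by
    rw [le_div_iff₀ (by positivity)]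
    nlinarith [sq_nonneg (L - 2 * lam * dist x (c k))]
  linarith

theorem le_quadSupConv [Finite κ] (hlam : 0 ≤ lam) (hh : LipschitzWith L h) {k : κ}
    (hk : dist x (c k) ≤ D) : h x - (L * D + lam * D ^ 2) ≤ quadSupConv lam h c x := by
  refine le_trans ?_ (le_ciSup (finite_range fun k => h (c k) - lam * dist x (c k) ^ 2).bddAbove k)
  have hlip := hh.le_add_mul x (c k)
  have hpenalty : L * dist x (c k) + lam * dist x (c k) ^ 2 ≤ L * D + lam * D ^ 2 := by gcongr
  linarith

theorem abs_quadSupConv_sub_quadSupConv_neg_le [Finite κ] (hlam : 0 < lam)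
    (hh : LipschitzWith L h) (hx : ∃ k, dist x (c k) ≤ D) :
    |quadSupConv lam h c x - quadSupConv lam (-h) c x - 2 * h x| ≤
      L * D + lam * D ^ 2 + L ^ 2 / (4 * lam) := by
  obtain ⟨k, hk⟩ := hx
  have : Nonempty κ := ⟨k⟩
  have hpos_upper := quadSupConv_le (c := c) (x := x) hlam hh
  have hpos_lower := le_quadSupConv hlam.le hh hk
  have hneg_upper := quadSupConv_le (c := c) (x := x) hlam hh.neg
  have hneg_lower := le_quadSupConv hlam.le hh.neg hk
  rw [Pi.neg_apply] at hneg_upper hneg_lower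
  exact abs_le.2 ⟨by linarith, by linarith⟩

end QuadraticSupConvolution

section Approximation

open Set Metric
open scoped NNReal

variable {p K : ℕ}

/-- The parameter of the difference of the maxima of the affine functions
`x ↦ lam * ‖x‖ ^ 2 ± h (c k) - lam * ‖x - c k‖ ^ 2`. -/
noncomputable def paraboloidParam (lam : ℝ) (h : EuclideanSpace ℝ (Fin p) → ℝ)
    (c : Fin K → EuclideanSpace ℝ (Fin p)) : PAParam p K :=
  (fun k j => 2 * lam * c k j, fun k => h (c k) - lam * ‖c k‖ ^ 2,
    fun k j => 2 * lam * c k j, fun k => -h (c k) - lam * ‖c k‖ ^ 2)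

theorem maxAffine_eq_norm_sq_add_quadSupConv [Nonempty (Fin K)] (lam : ℝ)
    (h : EuclideanSpace ℝ (Fin p) → ℝ) (c : Fin K → EuclideanSpace ℝ (Fin p))
    (x : EuclideanSpace ℝ (Fin p)) :
    maxAffine (fun k j => 2 * lam * c k j) (fun k => h (c k) - lam * ‖c k‖ ^ 2) x =
      lam * ‖x‖ ^ 2 + quadSupConv lam h c x := by
  unfold maxAffine quadSupConv
  rw [add_ciSup (finite_range _).bddAbove]
  congr 1
  ext k
  have hinner : ∑ j, 2 * lam * c k j * x j = 2 * lam * inner ℝ x (c k) := by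
    simp only [PiLp.inner_apply, Finset.mul_sum, RCLike.inner_apply, conj_trivial, mul_assoc]
  rw [hinner, dist_eq_norm, norm_sub_sq_real]
  ring

theorem paFun_paraboloidParam [Nonempty (Fin K)] (lam : ℝ) (h : EuclideanSpace ℝ (Fin p) → ℝ)
    (c : Fin K → EuclideanSpace ℝ (Fin p)) (x : EuclideanSpace ℝ (Fin p)) :
    paFun (paraboloidParam lam h c) x = quadSupConv lam h c x - quadSupConv lam (-h) c x := by
  have hpos := maxAffine_eq_norm_sq_add_quadSupConv lam h c x
  have hneg := maxAffine_eq_norm_sq_add_quadSupConv lam (-h) c x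
  simp only [Pi.neg_apply] at hneg
  rw [paFun, paraboloidParam, hpos, hneg]
  ring

theorem norm_paraboloidParam_le {lam X M : ℝ} {h : EuclideanSpace ℝ (Fin p) → ℝ}
    {c : Fin K → EuclideanSpace ℝ (Fin p)} (hlam : 0 ≤ lam) (hX : 0 ≤ X)
    (hc : ∀ k, ‖WithLp.ofLp (c k)‖ ≤ X) (hh : ∀ x, |h x| ≤ M) :
    ‖paraboloidParam lam h c‖ ≤ max (2 * lam * X) (lam * (p * X ^ 2) + M) := by
  have hbound : 0 ≤ max (2 * lam * X) (lam * (p * X ^ 2) + M) := le_max_of_le_left (by positivity)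
  have hslope : ‖fun k j => 2 * lam * c k j‖ ≤ max (2 * lam * X) (lam * (p * X ^ 2) + M) := by
    refine (pi_norm_le_iff_of_nonneg hbound).2 fun k => (pi_norm_le_iff_of_nonneg hbound).2
      fun j => le_max_of_le_left ?_
    rw [norm_mul, Real.norm_of_nonneg (by positivity)]
    gcongr
    exact (norm_le_pi_norm (WithLp.ofLp (c k)) j).trans (hc k)
  have hcentre : ∀ k, lam * ‖c k‖ ^ 2 ≤ lam * (p * X ^ 2) := fun k => by
    gcongr
    calc ‖c k‖ ^ 2 ≤ (√p * X) ^ 2 := by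
          gcongr
          exact (norm_le_sqrt_card_mul_norm_ofLp (c k)).trans (by simpa using by gcongr; exact hc k)
      _ = p * X ^ 2 := by rw [mul_pow, Real.sq_sqrt p.cast_nonneg]
  have hoffset : ∀ g : EuclideanSpace ℝ (Fin p) → ℝ, (∀ x, |g x| ≤ M) →
      ‖fun k => g (c k) - lam * ‖c k‖ ^ 2‖ ≤ max (2 * lam * X) (lam * (p * X ^ 2) + M) := by
    refine fun g hg => (pi_norm_le_iff_of_nonneg hbound).2 fun k => le_max_of_le_right ?_
    calc ‖g (c k) - lam * ‖c k‖ ^ 2‖ ≤ ‖g (c k)‖ + ‖lam * ‖c k‖ ^ 2‖ := norm_sub_le _ _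
      _ ≤ M + lam * (p * X ^ 2) := by
          rw [Real.norm_of_nonneg (by positivity : 0 ≤ lam * ‖c k‖ ^ 2)]
          exact add_le_add (hg _) (hcentre k)
      _ = lam * (p * X ^ 2) + M := add_comm _ _
  simp only [norm_prod_le_iff, paraboloidParam]
  exact ⟨hslope, hoffset h hh, hslope, hoffset (-h) fun x => (abs_neg _).trans_le (hh x)⟩

theorem exists_lipschitzWith_extension_of_abs_le {E : Type*} [PseudoMetricSpace E] {s : Set E}
    {f : s → ℝ} {L : ℝ≥0} {M : ℝ} (hM : 0 ≤ M) (hf : LipschitzWith L f) (hfM : ∀ x, |f x| ≤ M) :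
    ∃ g : E → ℝ, LipschitzWith L g ∧ (∀ x, |g x| ≤ M) ∧ ∀ x : s, g x = f x := by
  have hext : ∀ x : s, Function.extend Subtype.val f 0 x = f x :=
    Subtype.val_injective.extend_apply f 0
  have hlip : LipschitzOnWith L (Function.extend Subtype.val f 0) s := by
    rw [lipschitzOnWith_iff_restrict]
    convert hf
    exact funext hext
  obtain ⟨g, hg, hgf⟩ := hlip.extend_real
  refine ⟨Subtype.val ∘ projIcc (-M) M (neg_le_self hM) ∘ g, ?_,
    fun x => abs_le.2 (projIcc _ _ _ _).2, fun x => ?_⟩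
  · simpa only [one_mul] using
      LipschitzWith.subtype_val _ |>.comp ((LipschitzWith.projIcc (neg_le_self hM)).comp hg)
  · rw [Function.comp_apply, Function.comp_apply, ← hgf x.2, hext,
      projIcc_of_mem _ (abs_le.1 (hfM x))]

theorem exists_nat_pow_le_and_rpow_le (hp : 1 ≤ p) (hK : 1 ≤ K) :
    ∃ m : ℕ, 1 ≤ m ∧ m ^ p ≤ K ∧ (K : ℝ) ^ (1 / (p : ℝ)) ≤ 2 * m := by
  have hroot : 1 ≤ (K : ℝ) ^ (1 / (p : ℝ)) :=
    Real.one_le_rpow (by exact_mod_cast hK) (by positivity)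
  have hm : 1 ≤ ⌊(K : ℝ) ^ (1 / (p : ℝ))⌋₊ := Nat.le_floor (by simpa using hroot)
  refine ⟨_, hm, ?_, ?_⟩
  · have hpow : ((⌊(K : ℝ) ^ (1 / (p : ℝ))⌋₊ : ℝ)) ^ p ≤ K := by
      calc ((⌊(K : ℝ) ^ (1 / (p : ℝ))⌋₊ : ℝ)) ^ p ≤ ((K : ℝ) ^ (1 / (p : ℝ))) ^ p := by
            gcongr
            exact Nat.floor_le (by positivity)
        _ = K := by
            rw [one_div]
            exact Real.rpow_inv_natCast_pow K.cast_nonneg (by omega)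
    exact_mod_cast hpow
  · have hm' : (1 : ℝ) ≤ ⌊(K : ℝ) ^ (1 / (p : ℝ))⌋₊ := by exact_mod_cast hm
    linarith [Nat.lt_floor_add_one ((K : ℝ) ^ (1 / (p : ℝ)))]

theorem exists_fin_cover_norm_ofLp_le (hp : 1 ≤ p) (hK : 1 ≤ K) {X : ℝ} (hX : 0 ≤ X) :
    ∃ c : Fin K → EuclideanSpace ℝ (Fin p), (∀ k, ‖WithLp.ofLp (c k)‖ ≤ X) ∧
      ∀ x : EuclideanSpace ℝ (Fin p), ‖WithLp.ofLp x‖ ≤ X →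
        ∃ k, dist x (c k) ≤ 2 * √p * (X * (K : ℝ) ^ (-(1 / (p : ℝ)))) := by
  lift X to ℝ≥0 using hX
  obtain ⟨m, hm, hmK, hroot⟩ := exists_nat_pow_le_and_rpow_le hp hK
  have hcard : coveringNumber (X / m) (closedBall (0 : Fin p → ℝ) X) ≤ K := by
    refine (coveringNumber_closedBall_pi_le X.2
      fun _ => coveringNumber_closedBall_real_le 0 X hm).trans ?_
    rw [Fintype.card_fin]
    exact_mod_cast hmK
  obtain ⟨c, hcX, hc⟩ := exists_fin_cover_of_coveringNumber_le
    (nonempty_closedBall.2 X.2) hcard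
  refine ⟨fun k => WithLp.toLp 2 (c k), fun k => by simpa using hcX k, fun x hx => ?_⟩
  obtain ⟨k, hk⟩ := hc (WithLp.ofLp x) (by simpa using hx)
  have hmesh : (X : ℝ) / m ≤ 2 * (X * (K : ℝ) ^ (-(1 / (p : ℝ)))) := by
    have hK0 : 0 < (K : ℝ) := by exact_mod_cast hK
    have hm0 : 0 < (m : ℝ) := by exact_mod_cast hm
    rw [Real.rpow_neg hK0.le, ← div_eq_mul_inv, ← mul_div_assoc,
      div_le_div_iff₀ hm0 (by positivity)]
    calc (X : ℝ) * (K : ℝ) ^ (1 / (p : ℝ)) ≤ X * (2 * m) := by gcongr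
      _ = 2 * X * m := by ring
  refine ⟨k, ?_⟩
  calc dist x (WithLp.toLp 2 (c k)) ≤ √p * dist (WithLp.ofLp x) (c k) := by
        simpa [dist_eq_norm] using norm_le_sqrt_card_mul_norm_ofLp (x - WithLp.toLp 2 (c k))
    _ ≤ √p * (2 * (X * (K : ℝ) ^ (-(1 / (p : ℝ))))) := by
        gcongr
        exact (hk.trans_eq (by push_cast; rfl)).trans hmesh
    _ = 2 * √p * (X * (K : ℝ) ^ (-(1 / (p : ℝ)))) := by ring

theorem exists_paFun_approx (hp : 1 ≤ p) (hK : 1 ≤ K) {X M : ℝ} {L : ℝ≥0} (hX : 0 < X)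
    (hL : 0 < L) {g : EuclideanSpace ℝ (Fin p) → ℝ} (hg : LipschitzWith L g)
    (hgM : ∀ x, |g x| ≤ M) :
    ∃ θ : PAParam p K,
      ‖θ‖ ≤ max (1 / 2 * L * (K : ℝ) ^ (1 / (p : ℝ)))
        (1 / 4 * p * L * X * (K : ℝ) ^ (1 / (p : ℝ)) + 1 / 2 * M) ∧
      ∀ x, ‖WithLp.ofLp x‖ ≤ X →
        |paFun θ x - g x| ≤ 2 * (√p + 3) * √p * L * X * (K : ℝ) ^ (-(1 / (p : ℝ))) := by
  have : Nonempty (Fin K) := ⟨⟨0, hK⟩⟩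
  have hK0 : 0 < (K : ℝ) := by exact_mod_cast hK
  obtain ⟨c, hcX, hc⟩ := exists_fin_cover_norm_ofLp_le hp hK hX.le
  rw [Real.rpow_neg hK0.le] at hc ⊢
  set κ : ℝ := (K : ℝ) ^ (1 / (p : ℝ))
  have hκ : 0 < κ := by positivity
  have : (0 : ℝ) < L := hL
  -- At the mesh size `r = X / κ`, both `lam * r ^ 2` and `L ^ 2 / lam` are of order `L * X / κ`.
  set lam : ℝ := L * κ / (4 * X) with hlam_def
  have hlam : 0 < lam := by positivity
  have hhalf : LipschitzWith (L / 2) fun x => g x / 2 := by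
    simpa [div_eq_inv_mul, Function.comp_def] using (lipschitzWith_smul (2⁻¹ : ℝ)).comp hg
  refine ⟨paraboloidParam lam (fun x => g x / 2) c, ?_, fun x hx => ?_⟩
  · refine (norm_paraboloidParam_le hlam.le hX.le hcX (M := 1 / 2 * M) fun x => ?_).trans_eq ?_
    · rw [abs_div, abs_two]
      linarith [hgM x]
    · rw [hlam_def]
      congr 1 <;> field_simp
      ring
  · rw [paFun_paraboloidParam]
    have happrox := abs_quadSupConv_sub_quadSupConv_neg_le hlam hhalf (hc x hx)
    rw [mul_div_cancel₀ (g x) two_ne_zero] at happrox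
    refine happrox.trans ?_
    have hp_sqrt : 1 ≤ √(p : ℝ) := Real.one_le_sqrt.2 (by exact_mod_cast hp)
    calc _ = (√p + √p ^ 2 + 1 / 4) * (L * X * κ⁻¹) := by
          rw [hlam_def]
          push_cast
          field_simp
          ring
      _ ≤ (2 * (√p + 3) * √p) * (L * X * κ⁻¹) := by
          gcongr
          nlinarith
      _ = 2 * (√p + 3) * √p * L * X * κ⁻¹ := by ring

end Approximation

section PADRClass

open Metric Set
open scoped NNReal

variable {p d K : ℕ} {𝒳 : Set (EuclideanSpace ℝ (Fin p))} {X μ : ℝ}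

/-- The piecewise affine decision rule on `𝒳` with parameter `θ`. -/
noncomputable def padrRule (𝒳 : Set (EuclideanSpace ℝ (Fin p))) (θ : Fin d → PAParam p K) :
    𝒳 → EuclideanSpace ℝ (Fin d) :=
  fun x => WithLp.toLp 2 fun i => paFun (θ i) x

theorem padrClass_eq_image (hμ : 0 ≤ μ) :
    padrClass 𝒳 d K μ = padrRule (K := K) 𝒳 '' closedBall 0 μ := by
  ext f
  simp only [padrClass, mem_ofPred_eq, mem_image, mem_closedBall_zero_iff,
    pi_norm_le_iff_of_nonneg hμ]
  refine exists_congr fun θ => and_congr_right fun _ => ⟨fun hf => ?_, ?_⟩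
  · ext x i
    exact (hf x i).symm
  · rintro rfl x i
    rfl

@[fun_prop]
theorem continuous_padrRule {T : Type*} [TopologicalSpace T] {θ : T → Fin d → PAParam p K}
    {x : T → 𝒳} (hθ : Continuous θ) (hx : Continuous x) :
    Continuous fun t => padrRule 𝒳 (θ t) (x t) := by
  unfold padrRule
  fun_prop

theorem norm_padrRule_sub_le (h𝒳 : ∀ x ∈ 𝒳, ‖WithLp.ofLp x‖ ≤ X) (θ θ' : Fin d → PAParam p K)
    (x : 𝒳) : ‖padrRule 𝒳 θ x - padrRule 𝒳 θ' x‖ ≤ √d * (2 * (p * X + 1)) * ‖θ - θ'‖ := by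
  have hX : 0 ≤ X := (norm_nonneg _).trans (h𝒳 x x.2)
  calc ‖padrRule 𝒳 θ x - padrRule 𝒳 θ' x‖
      ≤ √d * ‖WithLp.ofLp (padrRule 𝒳 θ x - padrRule 𝒳 θ' x)‖ := by
        simpa using norm_le_sqrt_card_mul_norm_ofLp (padrRule 𝒳 θ x - padrRule 𝒳 θ' x)
    _ ≤ √d * (2 * (p * X + 1) * ‖θ - θ'‖) := by
        gcongr
        refine (pi_norm_le_iff_of_nonneg (by positivity)).2 fun i =>
          (abs_paFun_sub_paFun_le (θ i) (θ' i) x).trans ?_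
        gcongr
        exacts [h𝒳 x x.2, norm_le_pi_norm (θ - θ') i]
    _ = √d * (2 * (p * X + 1)) * ‖θ - θ'‖ := (mul_assoc _ _ _).symm

theorem padrRule_zero : padrRule 𝒳 (0 : Fin d → PAParam p K) = 0 := by
  ext x i
  simp [padrRule, paFun, maxAffine]

theorem norm_padrRule_le (h𝒳 : ∀ x ∈ 𝒳, ‖WithLp.ofLp x‖ ≤ X) {θ : Fin d → PAParam p K}
    (hθ : ‖θ‖ ≤ μ) (x : 𝒳) : ‖padrRule 𝒳 θ x‖ ≤ 2 * √d * μ * (p * X + 1) := by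
  have hX : 0 ≤ X := (norm_nonneg _).trans (h𝒳 x x.2)
  have h := norm_padrRule_sub_le h𝒳 θ 0 x
  rw [padrRule_zero, Pi.zero_apply, sub_zero, sub_zero] at h
  calc ‖padrRule 𝒳 θ x‖ ≤ √d * (2 * (p * X + 1)) * μ := h.trans (by gcongr)
    _ = 2 * √d * μ * (p * X + 1) := by ring

theorem ermSolutions_padrClass_nonempty {𝒴 : Type*} {n : ℕ} (hμ : 0 ≤ μ)
    {φ : EuclideanSpace ℝ (Fin d) → 𝒴 → ℝ} (hφ : ∀ y, Continuous (φ · y)) (S : Fin n → 𝒳 × 𝒴) :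
    (ermSolutions φ S (padrClass 𝒳 d K μ)).Nonempty := by
  have hcont : Continuous fun θ : Fin d → PAParam p K => empRisk φ S (padrRule 𝒳 θ) := by
    unfold empRisk
    exact continuous_const.mul <| continuous_finsetSum _ fun s _ => (hφ (S s).2).comp (by fun_prop)
  obtain ⟨θ, hθ, hmin⟩ := (isCompact_closedBall (0 : Fin d → PAParam p K) μ).exists_isMinOn
    (nonempty_closedBall.2 hμ) hcont.continuousOn
  rw [padrClass_eq_image hμ]
  exact ⟨padrRule 𝒳 θ, mem_image_of_mem _ hθ, forall_mem_image.2 fun _ hθ' => hmin hθ'⟩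

theorem exists_mem_padrClass_norm_sub_le (hp : 1 ≤ p) (hK : 1 ≤ K) {L M : ℝ} (hX : 0 < X)
    (hL : 0 < L) (hM : 0 ≤ M) (h𝒳 : ∀ x ∈ 𝒳, ‖WithLp.ofLp x‖ ≤ X)
    {f : 𝒳 → EuclideanSpace ℝ (Fin d)} (hf : f ∈ lipClass 𝒳 d L M)
    (hμ : max (1 / 2 * L * (K : ℝ) ^ (1 / (p : ℝ)))
      (1 / 4 * p * L * X * (K : ℝ) ^ (1 / (p : ℝ)) + 1 / 2 * M) ≤ μ) :
    ∃ g ∈ padrClass 𝒳 d K μ, ∀ x, ‖g x - f x‖ ≤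
      √d * (2 * (√p + 3) * √p * L * X * (K : ℝ) ^ (-(1 / (p : ℝ)))) := by
  lift L to ℝ≥0 using hL.le
  have hcomponent : ∀ i, LipschitzWith L fun x => f x i := fun i =>
    LipschitzWith.of_dist_le_mul fun x x' =>
      (PiLp.norm_apply_le (f x - f x') i).trans (hf.2 x x')
  choose g hg hgM hgf using fun i =>
    exists_lipschitzWith_extension_of_abs_le hM (hcomponent i) (hf.1 · i)
  choose θ hθ happrox using fun i =>
    exists_paFun_approx hp hK hX (NNReal.coe_pos.1 hL) (hg i) (hgM i)
  refine ⟨padrRule 𝒳 θ, ⟨θ, fun i => (hθ i).trans hμ, fun x i => rfl⟩, fun x => ?_⟩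
  calc ‖padrRule 𝒳 θ x - f x‖ ≤ √d * ‖WithLp.ofLp (padrRule 𝒳 θ x - f x)‖ := by
        simpa using norm_le_sqrt_card_mul_norm_ofLp (padrRule 𝒳 θ x - f x)
    _ ≤ √d * (2 * (√p + 3) * √p * L * X * (K : ℝ) ^ (-(1 / (p : ℝ)))) := by
        gcongr
        refine (pi_norm_le_iff_of_nonneg (by positivity)).2 fun i => ?_
        have hx := happrox i x (h𝒳 x x.2)
        rwa [hgf] at hx

end PADRClass

section Concentration

open Metric Set
open scoped NNReal BigOperators

theorem exists_measurableSet_subset_compl_of_measureReal_le {Ω : Type*} [MeasurableSpace Ω]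
    {Pr : Measure Ω} [IsProbabilityMeasure Pr] {bad : Set Ω} {δ : ℝ} (h : Pr.real bad ≤ δ) :
    ∃ E ⊆ badᶜ, MeasurableSet E ∧ ENNReal.ofReal (1 - δ) ≤ Pr E := by
  have hmeas := measurableSet_toMeasurable Pr bad
  refine ⟨(toMeasurable Pr bad)ᶜ, compl_subset_compl.2 (subset_toMeasurable _ _), hmeas.compl, ?_⟩
  rw [prob_compl_eq_one_sub hmeas, measure_toMeasurable,
    ENNReal.ofReal_sub _ (measureReal_nonneg.trans h), ENNReal.ofReal_one, ← ofReal_measureReal]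
  gcongr

theorem integral_le_add_of_abs_sub_le {β : Type*} [MeasurableSpace β] {P : Measure β}
    [IsProbabilityMeasure P] {g h : β → ℝ} (hg : Integrable g P) (hh : Integrable h P) {ε : ℝ}
    (hgh : ∀ b, |g b - h b| ≤ ε) : ∫ b, g b ∂P ≤ ∫ b, h b ∂P + ε := by
  calc ∫ b, g b ∂P ≤ ∫ b, (h b + ε) ∂P :=
        integral_mono hg (hh.add (integrable_const _)) fun b =>
          sub_le_iff_le_add'.1 (abs_le.1 (hgh b)).2
    _ = ∫ b, h b ∂P + ε := by rw [integral_add hh (integrable_const _)]; simp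

theorem expect_le_add_of_abs_sub_le {ι : Type*} [Fintype ι] [Nonempty ι] {u v : ι → ℝ} {ε : ℝ}
    (huv : ∀ i, |u i - v i| ≤ ε) : 𝔼 i, u i ≤ 𝔼 i, v i + ε := by
  calc 𝔼 i, u i ≤ 𝔼 i, (v i + ε) :=
        Finset.expect_le_expect fun i _ => sub_le_iff_le_add'.1 (abs_le.1 (huv i)).2
    _ = 𝔼 i, v i + ε := by rw [Finset.expect_add_distrib, Fintype.expect_const]

variable {β Ω ι : Type*} [MeasurableSpace β] {P : Measure β} [MeasurableSpace Ω] {Pr : Measure Ω}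
  [Fintype ι] {S : ι → Ω → β} {M : ℝ} {a : ℝ}

theorem hasSubgaussianMGF_integral_sub [IsProbabilityMeasure Pr] {Z : Ω → β} (hZ : HasLaw Z P Pr)
    {g : β → ℝ} (hg : Measurable g) (hgM : ∀ b, |g b| ≤ M) :
    HasSubgaussianMGF (fun ω => ∫ b, g b ∂P - g (Z ω)) ((‖M - -M‖₊ / 2) ^ 2) Pr := by
  have h := (hasSubgaussianMGF_of_mem_Icc (X := g ∘ Z) (hg.comp_aemeasurable hZ.aemeasurable)
    (Filter.Eventually.of_forall fun ω => abs_le.1 (hgM (Z ω)))).neg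
  rw [hZ.integral_comp hg.aestronglyMeasurable] at h
  simpa only [Pi.neg_def, Function.comp_apply, neg_sub] using h

theorem measureReal_expect_add_lt_integral_le [Nonempty ι] (hS_law : ∀ i, HasLaw (S i) P Pr)
    (hS_indep : iIndepFun S Pr) {g : β → ℝ} (hg : Measurable g) (hM : 0 < M)
    (hgM : ∀ b, |g b| ≤ M) (ha : 0 ≤ a) :
    Pr.real {ω | 𝔼 i, g (S i ω) + M * √(2 * a / Fintype.card ι) < ∫ b, g b ∂P} ≤
      Real.exp (-a) := by
  have := hS_indep.isProbabilityMeasure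
  have hcard : (0 : ℝ) < Fintype.card ι := by exact_mod_cast Fintype.card_pos
  have hindep : iIndepFun (fun i ω => ∫ b, g b ∂P - g (S i ω)) Pr :=
    hS_indep.comp (fun _ b => ∫ b, g b ∂P - g b) fun _ => hg.const_sub _
  set t := M * √(2 * a / Fintype.card ι) with ht
  have hhoeffding := HasSubgaussianMGF.measure_sum_ge_le_of_iIndepFun hindep (s := Finset.univ)
    (fun i _ => hasSubgaussianMGF_integral_sub (hS_law i) hg hgM)
    (ε := Fintype.card ι * t) (by positivity)
  have hvariance : (((‖M - -M‖₊ / 2) ^ 2 : ℝ≥0) : ℝ) = M ^ 2 := by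
    push_cast
    rw [Real.norm_of_nonneg (by linarith)]
    ring
  have hexponent : -(Fintype.card ι * t) ^ 2 / (2 * (Fintype.card ι * M ^ 2)) = -a := by
    rw [ht, mul_pow, mul_pow, Real.sq_sqrt (by positivity)]
    field_simp
  simp only [Finset.sum_const, Finset.card_univ, nsmul_eq_mul, NNReal.coe_mul, NNReal.coe_natCast,
    hvariance, hexponent] at hhoeffding
  refine (measureReal_mono fun ω hω => ?_).trans hhoeffding
  rw [mem_ofPred_eq, Fintype.expect_eq_sum_div_card] at hω
  rw [mem_ofPred_eq, Finset.sum_sub_distrib, Finset.sum_const, Finset.card_univ, nsmul_eq_mul]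
  have hscaled := mul_le_mul_of_nonneg_left hω.le hcard.le
  rw [mul_add, mul_div_cancel₀ _ hcard.ne'] at hscaled
  linarith

theorem measureReal_exists_expect_add_lt_integral_le [Nonempty ι]
    (hS_law : ∀ i, HasLaw (S i) P Pr) (hS_indep : iIndepFun S Pr) {κ : Type*} [Fintype κ]
    [Nonempty κ] {g : κ → β → ℝ} (hg : ∀ k, Measurable (g k)) (hM : 0 < M)
    (hgM : ∀ k b, |g k b| ≤ M) (ha : 0 ≤ a) :
    Pr.real {ω | ∃ k, 𝔼 i, g k (S i ω) +
      M * √(2 * (Real.log (Fintype.card κ) + a) / Fintype.card ι) < ∫ b, g k b ∂P} ≤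
      Real.exp (-a) := by
  have := hS_indep.isProbabilityMeasure
  have hcard : (0 : ℝ) < Fintype.card κ := by exact_mod_cast Fintype.card_pos
  rw [ofPred_exists]
  calc _ ≤ ∑ k, Pr.real {ω | 𝔼 i, g k (S i ω) +
        M * √(2 * (Real.log (Fintype.card κ) + a) / Fintype.card ι) < ∫ b, g k b ∂P} :=
        measureReal_iUnion_fintype_le _
    _ ≤ ∑ _k : κ, Real.exp (-(Real.log (Fintype.card κ) + a)) :=
        Finset.sum_le_sum fun k _ => measureReal_expect_add_lt_integral_le hS_law hS_indep (hg k)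
          hM (hgM k) (add_nonneg (Real.log_natCast_nonneg _) ha)
    _ = Real.exp (-a) := by
        rw [Finset.sum_const, Finset.card_univ, nsmul_eq_mul, neg_add, Real.exp_add,
          Real.exp_neg, Real.exp_log hcard, mul_inv_cancel_left₀ hcard.ne']

variable {Θ : Type*} [PseudoMetricSpace Θ] {T : Set Θ} {ε Λ : ℝ≥0} {N : ℕ} {ℓ : Θ → β → ℝ}

theorem measureReal_exists_mem_expect_add_lt_integral_le [Nonempty ι]
    (hS_law : ∀ i, HasLaw (S i) P Pr) (hS_indep : iIndepFun S Pr) (hT : T.Nonempty)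
    (hN : coveringNumber ε T ≤ N) (hℓ_meas : ∀ θ ∈ T, Measurable (ℓ θ)) (hM : 0 < M)
    (hℓ_bdd : ∀ θ ∈ T, ∀ b, |ℓ θ b| ≤ M) (hℓ_lip : ∀ b, LipschitzOnWith Λ (ℓ · b) T)
    (ha : 0 ≤ a) :
    Pr.real {ω | ∃ θ ∈ T, 𝔼 i, ℓ θ (S i ω) + 2 * Λ * ε +
      M * √(2 * (Real.log N + a) / Fintype.card ι) < ∫ b, ℓ θ b ∂P} ≤ Real.exp (-a) := by
  have := hS_indep.isProbabilityMeasure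
  have := (hS_law (Classical.arbitrary ι)).isProbabilityMeasure_iff.1 ‹_›
  obtain ⟨c, hcT, hc⟩ := exists_fin_cover_of_coveringNumber_le hT hN
  have : Nonempty (Fin N) := hT.elim fun θ hθ => ⟨(hc θ hθ).choose⟩
  have hℓ_int : ∀ θ ∈ T, Integrable (ℓ θ) P := fun θ hθ =>
    .of_bound (hℓ_meas θ hθ).aestronglyMeasurable M (.of_forall (hℓ_bdd θ hθ))
  have hunion := measureReal_exists_expect_add_lt_integral_le hS_law hS_indep
    (fun k => hℓ_meas _ (hcT k)) hM (fun k => hℓ_bdd _ (hcT k)) ha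
  rw [Fintype.card_fin] at hunion
  refine (measureReal_mono ?_).trans hunion
  rintro ω ⟨θ, hθ, hω⟩
  obtain ⟨k, hk⟩ := hc θ hθ
  have hclose : ∀ b, |ℓ θ b - ℓ (c k) b| ≤ Λ * ε := fun b =>
    ((hℓ_lip b).dist_le_mul _ hθ _ (hcT k)).trans (by gcongr)
  have hintegral := integral_le_add_of_abs_sub_le (hℓ_int θ hθ) (hℓ_int _ (hcT k)) hclose
  have hexpect := expect_le_add_of_abs_sub_le (u := fun i => ℓ (c k) (S i ω))
    fun i => (abs_sub_comm _ _).trans_le (hclose (S i ω))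
  exact ⟨k, by linarith⟩

theorem exists_event_integral_le_of_expect_le [Nonempty ι] (hS_law : ∀ i, HasLaw (S i) P Pr)
    (hS_indep : iIndepFun S Pr) (hN : coveringNumber ε T ≤ N)
    (hℓ_meas : ∀ θ ∈ T, Measurable (ℓ θ)) (hM : 0 < M) (hℓ_bdd : ∀ θ ∈ T, ∀ b, |ℓ θ b| ≤ M)
    (hℓ_lip : ∀ b, LipschitzOnWith Λ (ℓ · b) T) {θ₀ : Θ} (hθ₀ : θ₀ ∈ T) {δ : ℝ} (hδ : 0 < δ) :
    ∃ E : Set Ω, MeasurableSet E ∧ ENNReal.ofReal (1 - δ) ≤ Pr E ∧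
      ∀ ω ∈ E, ∀ θ ∈ T, 𝔼 i, ℓ θ (S i ω) ≤ 𝔼 i, ℓ θ₀ (S i ω) →
        ∫ b, ℓ θ b ∂P ≤ ∫ b, ℓ θ₀ b ∂P + 2 * Λ * ε +
          M * √(2 * (Real.log N + Real.log (2 / δ)) / Fintype.card ι) +
          M * √(2 * Real.log (2 / δ) / Fintype.card ι) := by
  obtain hδ1 | hδ1 := lt_or_ge 1 δ
  · exact ⟨∅, .empty, by simp [hδ1.le], by simp⟩
  have := hS_indep.isProbabilityMeasure
  have hlog : 0 ≤ Real.log (2 / δ) := Real.log_nonneg (by rw [le_div_iff₀ hδ]; linarith)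
  have hexp : Real.exp (-Real.log (2 / δ)) = δ / 2 := by
    rw [Real.exp_neg, Real.exp_log (by positivity), inv_div]
  have huniform := measureReal_exists_mem_expect_add_lt_integral_le hS_law hS_indep ⟨θ₀, hθ₀⟩ hN
    hℓ_meas hM hℓ_bdd hℓ_lip hlog
  have hcomparator := measureReal_expect_add_lt_integral_le hS_law hS_indep
    (hℓ_meas θ₀ hθ₀).neg hM (fun b => (abs_neg _).trans_le (hℓ_bdd θ₀ hθ₀ b)) hlog
  have hbad := (measureReal_union_le _ _).trans (add_le_add huniform hcomparator)
  rw [hexp, add_halves] at hbad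
  obtain ⟨E, hE_good, hE_meas, hE_prob⟩ := exists_measurableSet_subset_compl_of_measureReal_le hbad
  refine ⟨E, hE_meas, hE_prob, fun ω hω θ hθ hmin => ?_⟩
  have hgood := hE_good hω
  simp only [compl_union, mem_inter_iff, mem_compl_iff, mem_ofPred_eq, not_exists, not_and,
    not_lt, Pi.neg_apply, Finset.expect_neg_distrib, integral_neg] at hgood
  linarith [hgood.1 θ hθ, hgood.2]

end Concentration

section Loss

open scoped BigOperators

theorem extExpectation_eq_integral {Ω : Type*} [MeasurableSpace Ω] {P : Measure Ω} {g : Ω → ℝ}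
    (hg : Integrable g P) : extExpectation P g = ((∫ ω, g ω ∂P : ℝ) : EReal) := by
  have hneg : ∫⁻ ω, ENNReal.ofReal (-g ω) ∂P ≠ ⊤ := hg.neg.lintegral_lt_top.ne
  rw [extExpectation, if_neg hg.lintegral_lt_top.ne,
    integral_eq_lintegral_pos_part_sub_lintegral_neg_part hg, EReal.coe_sub,
    EReal.coe_ennreal_toReal hg.lintegral_lt_top.ne, EReal.coe_ennreal_toReal hneg]

theorem empRisk_eq_expect {𝒳 𝒴 Z : Type*} {n : ℕ} (φ : Z → 𝒴 → ℝ) (S : Fin n → 𝒳 × 𝒴)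
    (f : 𝒳 → Z) : empRisk φ S f = 𝔼 s, φ (f (S s).1) (S s).2 := by
  rw [empRisk, Fintype.expect_eq_sum_div_card, Fintype.card_fin, one_div_mul_eq_div]

variable {𝒳 𝒴 Z : Type*} [MeasurableSpace 𝒴] [NormedAddCommGroup Z]

/-- A cost `φ z y` of the decision `z` under the outcome `y` that is measurable in `y`,
`L`-Lipschitz in `z` uniformly in `y`, and bounded by `C` at the reference decision `z₀`. -/
structure IsLipschitzCost (φ : Z → 𝒴 → ℝ) (L C : ℝ) (z₀ : Z) : Prop where
  measurable : ∀ z, Measurable (φ z)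
  abs_sub_le : ∀ y z z', |φ z y - φ z' y| ≤ L * ‖z - z'‖
  abs_le : ∀ y, |φ z₀ y| ≤ C

namespace IsLipschitzCost

variable {φ : Z → 𝒴 → ℝ} {L C B : ℝ} {z₀ : Z}

theorem continuous (hφ : IsLipschitzCost φ L C z₀) (y : 𝒴) : Continuous (φ · y) := by
  refine (LipschitzWith.of_dist_le_mul (K := L.toNNReal) fun z z' => ?_).continuous
  rw [dist_eq_norm z z']
  exact (hφ.abs_sub_le y z z').trans (by gcongr; exact L.le_coe_toNNReal)

theorem abs_apply_le (hφ : IsLipschitzCost φ L C z₀) (hL : 0 ≤ L) {z : Z} (hz : ‖z‖ ≤ B) (y : 𝒴) :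
    |φ z y| ≤ C + L * (B + ‖z₀‖) := by
  have hnorm : ‖z - z₀‖ ≤ B + ‖z₀‖ := (norm_sub_le z z₀).trans (by gcongr)
  calc |φ z y| ≤ |φ z₀ y| + |φ z y - φ z₀ y| := by
        linarith [abs_sub_abs_le_abs_sub (φ z y) (φ z₀ y)]
    _ ≤ C + L * (B + ‖z₀‖) :=
        add_le_add (hφ.abs_le y) ((hφ.abs_sub_le y z z₀).trans (by gcongr))

variable [MeasurableSpace 𝒳] [MeasurableSpace Z] [BorelSpace Z] [SecondCountableTopology Z]
  {P : Measure (𝒳 × 𝒴)} {f g : 𝒳 → Z}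

theorem measurable_loss (hφ : IsLipschitzCost φ L C z₀) (hf : Measurable f) :
    Measurable fun q : 𝒳 × 𝒴 => φ (f q.1) q.2 :=
  (measurable_uncurry_of_continuous_of_measurable hφ.continuous hφ.measurable).comp
    ((hf.comp measurable_fst).prodMk measurable_snd)

theorem integrable_loss [IsFiniteMeasure P] (hφ : IsLipschitzCost φ L C z₀) (hL : 0 ≤ L)
    (hf : Measurable f) (hfB : ∀ x, ‖f x‖ ≤ B) :
    Integrable (fun q : 𝒳 × 𝒴 => φ (f q.1) q.2) P :=
  .of_bound (hφ.measurable_loss hf).aestronglyMeasurable (C + L * (B + ‖z₀‖))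
    (.of_forall fun q => hφ.abs_apply_le hL (hfB q.1) q.2)

theorem risk_eq_integral [IsFiniteMeasure P] (hφ : IsLipschitzCost φ L C z₀) (hL : 0 ≤ L)
    (hf : Measurable f) (hfB : ∀ x, ‖f x‖ ≤ B) :
    risk P φ f = ((∫ q, φ (f q.1) q.2 ∂P : ℝ) : EReal) :=
  extExpectation_eq_integral (hφ.integrable_loss hL hf hfB)

theorem risk_le_add_of_norm_sub_le [IsProbabilityMeasure P] (hφ : IsLipschitzCost φ L C z₀)
    (hL : 0 ≤ L) (hf : Measurable f) (hfB : ∀ x, ‖f x‖ ≤ B) (hg : Measurable g) {ε : ℝ}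
    (hgf : ∀ x, ‖g x - f x‖ ≤ ε) : risk P φ g ≤ risk P φ f + ((L * ε : ℝ) : EReal) := by
  have hgB : ∀ x, ‖g x‖ ≤ B + ε := fun x => by
    linarith [norm_le_insert' (g x) (f x), hfB x, hgf x]
  rw [hφ.risk_eq_integral hL hg hgB, hφ.risk_eq_integral hL hf hfB, ← EReal.coe_add,
    EReal.coe_le_coe_iff]
  exact integral_le_add_of_abs_sub_le (hφ.integrable_loss hL hg hgB)
    (hφ.integrable_loss hL hf hfB) fun q =>
      (hφ.abs_sub_le q.2 _ _).trans (by gcongr; exact hgf q.1)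

end IsLipschitzCost

end Loss

section ExcessRisk

open Metric Set
open scoped NNReal

theorem sqrt_add_le_sqrt_add_sqrt (x y : ℝ) : √(x + y) ≤ √x + √y := by
  refine Real.sqrt_le_iff.2 ⟨by positivity, ?_⟩
  rw [add_sq, Real.sq_sqrt', Real.sq_sqrt']
  have hcross : 0 ≤ 2 * √x * √y := by positivity
  linarith [le_max_left x 0, le_max_left y 0]

theorem sqrt_mul_add_one_le {d K p : ℕ} (hK : 1 ≤ K) (X : ℝ) :
    √d * (p * X + 1) ≤ √(2 * d * K * (p + 1) * (p * X ^ 2 + 1)) := by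
  have hK' : (1 : ℝ) ≤ K := by exact_mod_cast hK
  refine Real.le_sqrt_of_sq_le ?_
  rw [mul_pow, Real.sq_sqrt d.cast_nonneg]
  have hcauchySchwarz : (p * X + 1) ^ 2 ≤ ((p : ℝ) + 1) * (p * X ^ 2 + 1) := by
    nlinarith [mul_nonneg (p.cast_nonneg (α := ℝ)) (sq_nonneg (X - 1))]
  calc (d : ℝ) * (p * X + 1) ^ 2 ≤ d * (((p : ℝ) + 1) * (p * X ^ 2 + 1)) := by gcongr
    _ = d * 1 * (((p : ℝ) + 1) * (p * X ^ 2 + 1)) := by ring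
    _ ≤ d * (2 * K) * (((p : ℝ) + 1) * (p * X ^ 2 + 1)) := by
        gcongr
        linarith
    _ = 2 * d * K * (p + 1) * (p * X ^ 2 + 1) := by ring

theorem sqrt_log_pow_add_le (q n : ℕ) (l : ℝ) :
    √(2 * (Real.log (n ^ q : ℕ) + l) / n) ≤ 4 * √(q * Real.log n / n) + √2 * √(l / n) := by
  have hsqrt_two : √(2 : ℝ) ≤ 4 := Real.sqrt_le_iff.2 ⟨by norm_num, by norm_num⟩
  calc √(2 * (Real.log (n ^ q : ℕ) + l) / n) = √2 * √(q * Real.log n / n + l / n) := by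
        rw [Nat.cast_pow, Real.log_pow, mul_div_assoc, Real.sqrt_mul zero_le_two, add_div]
    _ ≤ √2 * (√(q * Real.log n / n) + √(l / n)) := by
        gcongr
        exact sqrt_add_le_sqrt_add_sqrt _ _
    _ ≤ 4 * √(q * Real.log n / n) + √2 * √(l / n) := by
        rw [mul_add]
        gcongr

theorem estimation_error_le {d n K p : ℕ} (hK : 1 ≤ K) {X L μ M l : ℝ} (hL : 0 ≤ L) (hμ : 0 ≤ μ)
    (hM : 0 ≤ M) :
    2 * (L * (√d * (2 * (p * X + 1)))) * (μ / n) +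
        M * √(2 * (Real.log (n ^ (2 * d * K * (p + 1)) : ℕ) + l) / n) + M * √(2 * l / n) ≤
      16 * μ * L * √(2 * d * K * (p + 1) * (p * X ^ 2 + 1)) / n
        + 4 * M * √(2 * d * K * (p + 1) * Real.log n / n) + 2 * √2 * M * √(l / n) := by
  have hdeviation := sqrt_log_pow_add_le (2 * d * K * (p + 1)) n l
  push_cast at hdeviation
  have hdiscretization : 2 * (L * (√d * (2 * (p * X + 1)))) * (μ / n) ≤
      16 * μ * L * √(2 * d * K * (p + 1) * (p * X ^ 2 + 1)) / n := by
    calc _ = 4 * (μ * L / n) * (√d * (p * X + 1)) := by ring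
      _ ≤ 4 * (μ * L / n) * √(2 * d * K * (p + 1) * (p * X ^ 2 + 1)) := by
          gcongr
          exact sqrt_mul_add_one_le hK X
      _ ≤ 16 * (μ * L / n) * √(2 * d * K * (p + 1) * (p * X ^ 2 + 1)) := by
          gcongr
          norm_num
      _ = _ := by ring
  rw [mul_div_assoc 2 l, Real.sqrt_mul zero_le_two]
  push_cast
  linarith [mul_le_mul_of_nonneg_left hdeviation hM]

variable {p d n K : ℕ} {𝒳 : Set (EuclideanSpace ℝ (Fin p))} {X : ℝ}
  {𝒴 : Type*} [MeasurableSpace 𝒴] {P : Measure (𝒳 × 𝒴)}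
  {Ω : Type*} [MeasurableSpace Ω] {Pr : Measure Ω} {S : Fin n → Ω → 𝒳 × 𝒴}
  {φ : EuclideanSpace ℝ (Fin d) → 𝒴 → ℝ} {Lφ Cφ : ℝ} {z₀ : EuclideanSpace ℝ (Fin d)} {μ Mμ δ : ℝ}

theorem exists_event_risk_le_of_mem_ermSolutions_padrClass [IsProbabilityMeasure P] (hn : 1 ≤ n)
    (hK : 1 ≤ K) (hX : 0 ≤ X) (h𝒳 : ∀ x ∈ 𝒳, ‖WithLp.ofLp x‖ ≤ X)
    (hS_law : ∀ s, HasLaw (S s) P Pr) (hS_indep : iIndepFun S Pr)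
    (hφ : IsLipschitzCost φ Lφ Cφ z₀) (hLφ : 0 ≤ Lφ) (hμ : 0 ≤ μ)
    (hMμ : Mμ = Cφ + Lφ * (2 * √d * μ * (p * X + 1) + ‖z₀‖)) (hMμ_pos : 0 < Mμ)
    {g : 𝒳 → EuclideanSpace ℝ (Fin d)} (hg : g ∈ padrClass 𝒳 d K μ) (hδ : 0 < δ) :
    ∃ E : Set Ω, MeasurableSet E ∧ ENNReal.ofReal (1 - δ) ≤ Pr E ∧
      ∀ ω ∈ E, ∀ f ∈ ermSolutions φ (fun s => S s ω) (padrClass 𝒳 d K μ),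
        risk P φ f ≤ risk P φ g +
          ((16 * μ * Lφ * √(2 * d * K * (p + 1) * (p * X ^ 2 + 1)) / n
            + 4 * Mμ * √(2 * d * K * (p + 1) * Real.log n / n)
            + 2 * √2 * Mμ * √(Real.log (2 / δ) / n) : ℝ) : EReal) := by
  have : Nonempty (Fin n) := ⟨⟨0, hn⟩⟩
  rw [padrClass_eq_image hμ] at hg ⊢
  obtain ⟨θ₀, hθ₀, rfl⟩ := hg
  have hmeas : ∀ θ : Fin d → PAParam p K, Measurable (padrRule 𝒳 θ) := fun θ =>
    Continuous.measurable (by fun_prop)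
  have hbdd : ∀ θ : Fin d → PAParam p K, θ ∈ closedBall 0 μ → ∀ x,
      ‖padrRule 𝒳 θ x‖ ≤ 2 * √d * μ * (p * X + 1) := fun θ hθ =>
    norm_padrRule_le h𝒳 (mem_closedBall_zero_iff.1 hθ)
  have hlip : ∀ q : 𝒳 × 𝒴, LipschitzOnWith (Lφ * (√d * (2 * (p * X + 1)))).toNNReal
      (fun θ : Fin d → PAParam p K => φ (padrRule 𝒳 θ q.1) q.2) (closedBall 0 μ) := fun q =>
    LipschitzOnWith.of_dist_le_mul fun θ _ θ' _ => by
      rw [Real.coe_toNNReal _ (by positivity), mul_assoc, dist_eq_norm θ]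
      refine (hφ.abs_sub_le _ _ _).trans ?_
      gcongr
      exact norm_padrRule_sub_le h𝒳 θ θ' q.1
  lift μ to ℝ≥0 using hμ
  obtain ⟨E, hE_meas, hE_prob, hE⟩ := exists_event_integral_le_of_expect_le hS_law hS_indep
    (coveringNumber_closedBall_paParam_le d p K μ hn) (fun θ _ => hφ.measurable_loss (hmeas θ))
    hMμ_pos (fun θ hθ q => hMμ ▸ hφ.abs_apply_le hLφ (hbdd θ hθ q.1) q.2) hlip hθ₀ hδ
  refine ⟨E, hE_meas, hE_prob, fun ω hω f ⟨hf, hmin⟩ => ?_⟩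
  obtain ⟨θ, hθ, rfl⟩ := hf
  have hERM := hmin _ (mem_image_of_mem _ hθ₀)
  rw [empRisk_eq_expect, empRisk_eq_expect] at hERM
  rw [hφ.risk_eq_integral hLφ (hmeas θ) (hbdd θ hθ),
    hφ.risk_eq_integral hLφ (hmeas θ₀) (hbdd θ₀ hθ₀), ← EReal.coe_add, EReal.coe_le_coe_iff]
  have hintegral := hE ω hω θ hθ hERM
  rw [Real.coe_toNNReal _ (by positivity), NNReal.coe_div, NNReal.coe_natCast,
    Fintype.card_fin] at hintegral
  linarith [estimation_error_le (d := d) (n := n) (p := p) (X := X) (l := Real.log (2 / δ))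
    hK hLφ μ.coe_nonneg hMμ_pos.le]

theorem measurable_of_mem_lipClass {L M : ℝ} {f : 𝒳 → EuclideanSpace ℝ (Fin d)}
    (hf : f ∈ lipClass 𝒳 d L M) : Measurable f := by
  refine (LipschitzWith.of_dist_le_mul (K := L.toNNReal) fun x x' => ?_).continuous.measurable
  rw [dist_eq_norm, Subtype.dist_eq, dist_eq_norm]
  exact (hf.2 x x').trans (by gcongr; exact L.le_coe_toNNReal)

theorem norm_le_of_mem_lipClass {L M : ℝ} (hM : 0 ≤ M) {f : 𝒳 → EuclideanSpace ℝ (Fin d)}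
    (hf : f ∈ lipClass 𝒳 d L M) (x : 𝒳) : ‖f x‖ ≤ √d * M := by
  calc ‖f x‖ ≤ √d * ‖WithLp.ofLp (f x)‖ := by simpa using norm_le_sqrt_card_mul_norm_ofLp (f x)
    _ ≤ √d * M := by
        gcongr
        exact (pi_norm_le_iff_of_nonneg hM).2 (hf.1 x)

theorem measurable_of_mem_padrClass {f : 𝒳 → EuclideanSpace ℝ (Fin d)}
    (hf : f ∈ padrClass 𝒳 d K μ) : Measurable f := by
  obtain ⟨θ, -, hfθ⟩ := hf
  have hrule : f = padrRule 𝒳 θ := by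
    ext x i
    exact hfθ x i
  rw [hrule]
  exact Continuous.measurable (by fun_prop)

theorem theorem1_general (hn : 1 ≤ n) (hp : 1 ≤ p) (hK : 1 ≤ K) (hX : 0 < X)
    (h𝒳 : ∀ x ∈ 𝒳, ‖WithLp.ofLp x‖ ≤ X)
    (hS_law : ∀ s, HasLaw (S s) P Pr) (hS_indep : iIndepFun S Pr)
    (hφ : IsLipschitzCost φ Lφ Cφ z₀) (hLφ : 0 ≤ Lφ) (hCφ : 0 < Cφ)
    {Lz Mz : ℝ} (hLz : 0 < Lz) (hMz : 0 ≤ Mz)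
    {f₀ : 𝒳 → EuclideanSpace ℝ (Fin d)} (hf₀ : f₀ ∈ lipClass 𝒳 d Lz Mz)
    (hμ : max (1 / 2 * Lz * (K : ℝ) ^ (1 / (p : ℝ)))
      (1 / 4 * p * Lz * X * (K : ℝ) ^ (1 / (p : ℝ)) + 1 / 2 * Mz) ≤ μ)
    (hMμ : Mμ = Cφ + Lφ * (2 * √d * μ * (p * X + 1) + ‖z₀‖)) (hδ : 0 < δ) :
    (∀ ω, (ermSolutions φ (fun s => S s ω) (padrClass 𝒳 d K μ)).Nonempty) ∧
    ∃ E : Set Ω, MeasurableSet E ∧ ENNReal.ofReal (1 - δ) ≤ Pr E ∧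
      ∀ ω ∈ E, ∀ f ∈ ermSolutions φ (fun s => S s ω) (padrClass 𝒳 d K μ),
        risk P φ f ≤ risk P φ f₀ +
          ((2 * √d * (√p + 3) * √p * Lφ * Lz * X * (K : ℝ) ^ (-(1 / (p : ℝ)))
            + 16 * μ * Lφ * √(2 * d * K * (p + 1) * (p * X ^ 2 + 1)) / n
            + 4 * Mμ * √(2 * d * K * (p + 1) * Real.log n / n)
            + 2 * √2 * Mμ * √(Real.log (2 / δ) / n) : ℝ) : EReal) := by
  have := hS_indep.isProbabilityMeasure
  have := (hS_law ⟨0, hn⟩).isProbabilityMeasure_iff.1 ‹_›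
  have hμ_nonneg : 0 ≤ μ := le_trans (by positivity) hμ
  have hMμ_pos : 0 < Mμ := hMμ ▸ by positivity
  obtain ⟨g, hg, hgf₀⟩ := exists_mem_padrClass_norm_sub_le hp hK hX hLz hMz h𝒳 hf₀ hμ
  have happrox := hφ.risk_le_add_of_norm_sub_le (P := P) hLφ (measurable_of_mem_lipClass hf₀)
    (norm_le_of_mem_lipClass hMz hf₀) (measurable_of_mem_padrClass hg) hgf₀
  obtain ⟨E, hE_meas, hE_prob, hE⟩ := exists_event_risk_le_of_mem_ermSolutions_padrClass hn hK
    hX.le h𝒳 hS_law hS_indep hφ hLφ hμ_nonneg hMμ hMμ_pos hg hδ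
  refine ⟨fun ω => ermSolutions_padrClass_nonempty hμ_nonneg hφ.continuous _, E, hE_meas, hE_prob,
    fun ω hω f hf => (hE ω hω f hf).trans ((add_le_add_left happrox _).trans_eq ?_)⟩
  rw [add_assoc, ← EReal.coe_add]
  congr 2
  ring

theorem one_le_of_norm_ofLp_pos {x : EuclideanSpace ℝ (Fin p)} (hx : 0 < ‖WithLp.ofLp x‖) :
    1 ≤ p := by
  rw [Nat.one_le_iff_ne_zero]
  rintro rfl
  simp [Subsingleton.elim (WithLp.ofLp x) 0] at hx

end ExcessRisk

theorem theorem1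
    {p d n K : ℕ} (hn : 1 ≤ n) (hK : 1 ≤ K)
    -- the compact feature support, and the largest sup-norm of a feature
    (𝒳 : Set (EuclideanSpace ℝ (Fin p))) (h𝒳 : IsCompact 𝒳)
    (Xbar : ℝ) (hXbar_pos : 0 < Xbar)
    (hXbar : IsGreatest ((fun x : EuclideanSpace ℝ (Fin p) => ‖WithLp.ofLp x‖) '' 𝒳) Xbar)
    -- the joint law of `(X, Y)`
    {𝒴 : Type*} [MeasurableSpace 𝒴] (P : Measure (𝒳 × 𝒴)) [IsProbabilityMeasure P]
    -- an i.i.d. sample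
    {Ω : Type*} [MeasurableSpace Ω] (Pr : Measure Ω) [IsProbabilityMeasure Pr]
    (S : Fin n → Ω → 𝒳 × 𝒴) (hS_law : ∀ s, HasLaw (S s) P Pr) (hS_indep : iIndepFun S Pr)
    -- the cost function
    (φ : EuclideanSpace ℝ (Fin d) → 𝒴 → ℝ) (hφ_meas : ∀ z, Measurable (φ z))
    (Lφ Cφ : ℝ) (hLφ : 0 < Lφ) (hCφ : 0 < Cφ) (z₀ : EuclideanSpace ℝ (Fin d))
    (hφ_lip : ∀ y z z', |φ z y - φ z' y| ≤ Lφ * ‖z - z'‖)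
    (hφ_bdd : ∀ y, |φ z₀ y| ≤ Cφ)
    -- the optimal decision rule
    (fstar : 𝒳 → EuclideanSpace ℝ (Fin d))
    (hopt : ∀ g : 𝒳 → EuclideanSpace ℝ (Fin d), Measurable g → risk P φ fstar ≤ risk P φ g)
    (Lz Mz : ℝ) (hLz : 0 < Lz) (hMz : 0 < Mz) (hfstar : fstar ∈ lipClass 𝒳 d Lz Mz)
    -- the size of the parameters
    (μ : ℝ)
    (hμ : max (1 / 2 * Lz * (K : ℝ) ^ (1 / (p : ℝ)))
      (1 / 4 * p * Lz * Xbar * (K : ℝ) ^ (1 / (p : ℝ)) + 1 / 2 * Mz) ≤ μ)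
    (Mμ : ℝ) (hMμ : Mμ = Cφ + Lφ * (2 * √d * μ * (p * Xbar + 1) + ‖z₀‖))
    (δ : ℝ) (hδ : 0 < δ) :
    (∀ ω, (ermSolutions φ (fun s => S s ω) (padrClass 𝒳 d K μ)).Nonempty) ∧
    ∃ E : Set Ω, MeasurableSet E ∧ ENNReal.ofReal (1 - δ) ≤ Pr E ∧
      ∀ ω ∈ E, ∀ f ∈ ermSolutions φ (fun s => S s ω) (padrClass 𝒳 d K μ),
        risk P φ f ≤
          (⨅ (g : 𝒳 → EuclideanSpace ℝ (Fin d)) (_ : Measurable g), risk P φ g) +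
          ((2 * √d * (√p + 3) * √p * Lφ * Lz * Xbar * (K : ℝ) ^ (-(1 / (p : ℝ)))
            + 16 * μ * Lφ * √(2 * d * K * (p + 1) * (p * Xbar ^ 2 + 1)) / n
            + 4 * Mμ * √(2 * d * K * (p + 1) * Real.log n / n)
            + 2 * √2 * Mμ * √(Real.log (2 / δ) / n) : ℝ) : EReal) := by
  obtain ⟨⟨x, -, hx⟩, hXbar_max⟩ := hXbar
  have hp : 1 ≤ p := one_le_of_norm_ofLp_pos (hXbar_pos.trans_eq hx.symm)
  obtain ⟨hne, E, hE_meas, hE_prob, hE⟩ := theorem1_general hn hp hK hXbar_pos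
    (fun x hx => hXbar_max ⟨x, hx, rfl⟩) hS_law hS_indep ⟨hφ_meas, hφ_lip, hφ_bdd⟩ hLφ.le hCφ
    hLz hMz.le hfstar hμ hMμ hδ
  exact ⟨hne, E, hE_meas, hE_prob, fun ω hω f hf =>
    (hE ω hω f hf).trans (add_le_add_left (le_iInf₂ hopt) _)⟩
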